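/- Let $G$ be a finite group. A rational $G$-Mackey functor $M$ consists of $\mathbb{Q}$-modules $M(G/H)$ for all subgroups $H\leqslant G$ with linear maps $R^H_K\colon M(G/H)\to M(G/K)$ (restriction) and $I^H_K\colon M(G/K)\to M(G/H)$ (induction) for $K\leqslant H$, and $C_g\colon M(G/H)\to M(G/gHg^{-1})$ (conjugation) for $g\in G$, such that (1) $R^H_H=I^H_H=\mathrm{id}$, and $C_h=\mathrm{id}$ on $M(G/H)$ for $h\in H$; (2) $I^H_L=I^H_K I^K_L$ and $R^H_L=R^K_L R^H_K$ for $L\leqslant K\leqslant H$, and $C_{gh}=C_gC_h$ for $g,h\in G$; (3) $R^{gHg^{-1}}_{gKg^{-1}}C_g=C_gR^H_K$ and $I^{gHg^{-1}}_{gKg^{-1}}C_g=C_gI^H_K$ for $K\leqslant H$ and $g\in G$; (4) $R^H_K I^H_L=\sum_{x} I^K_{K\cap xLx^{-1}}\, C_x\, R^L_{L\cap x^{-1}Kx}$ for $K,L\leqslant H$, where $x$ runs over a set of representatives of the double cosets $K\backslash H/L$. A morphism $M\to N$ is a family of linear maps $M(G/H)\to N(G/H)$ that commutes with restriction, induction and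 conjugation. For $H\leqslant G$ the rational Burnside ring $A_{\mathbb{Q}}(H)$ has as additive basis the classes $[H/K]$ of the transitive $H$-sets, one for each $H$-conjugacy class of subgroups $K\leqslant H$. It acts on $M(G/H)$ through the linear extension of $[H/K]\mapsto I^H_K R^H_K$. Let $e_H^H\in A_{\mathbb{Q}}(H)$ be the idempotent that corresponds to the characteristic function of the class $(H)$ under the isomorphism $A_{\mathbb{Q}}(H)\cong\prod_{(L)\leqslant H}\mathbb{Q}$, $[T]\mapsto(|T^L|)_{(L)}$. The subspace $e_H^HM(G/H)\subseteq M(G/H)$ is stable under the maps $C_n$ with $n\in N_GH$, and so it is a module over $\mathbb{Q}[W_GH]$, where $W_GH=N_GH/H$. Then a rational $G$-Mackey functor is determined up to isomorphism by the $\mathbb{Q}[W_GH]$-modules $e_H^HM(G/H)$, one for each conjugacy class $(H)$ of subgroups of $G$: choose a representative $H$ of each conjugacy class. Two rational $G$-Mackey functors $M$ and $N$ are isomorphic if and only if, for each chosen $H$, the $\mathbb{Q}[W_GH]$-modules $e_H^HM(G/H)$ and $e_H^HN(G/H)$ are isomorphic. -/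

import Mathlib

open scoped Pointwise
open CategoryTheory

universe u v

noncomputable section

/-! ### Conjugacy classes of subgroups -/

/-- Two subgroups `K`, `L` of `G` are conjugate if `g K g⁻¹ = L` for some `g : G`. -/
def subgroupConjSetoid (G : Type u) [Group G] : Setoid (Subgroup G) where
  r K L := ∃ g : G, MulAut.conj g • K = L
  iseqv :=
    { refl := fun K => ⟨1, by simp⟩
      symm := by
        rintro K L ⟨g, rfl⟩
        exact ⟨g⁻¹, by rw [map_inv, inv_smul_smul]⟩
      trans := by
        rintro K L P ⟨g, rfl⟩ ⟨h, rfl⟩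
        exact ⟨h * g, by rw [map_mul, mul_smul]⟩ }

/-- The set of conjugacy classes `(K)` of subgroups of `G`. -/
abbrev SubgroupConjClass (G : Type u) [Group G] : Type u := Quotient (subgroupConjSetoid G)

/-- The conjugacy class `(K)` of a subgroup `K`. -/
abbrev SubgroupConjClass.mk {G : Type u} [Group G] (K : Subgroup G) : SubgroupConjClass G :=
  Quotient.mk (subgroupConjSetoid G) K

/-- The Weyl group `W_G H = N_G H / H`. -/
abbrev WeylGroup {G : Type u} [Group G] (H : Subgroup G) : Type u :=
  Subgroup.normalizer (H : Set G) ⧸ H.subgroupOf (Subgroup.normalizer (H : Set G))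

/-! ### The rational Burnside ring and its idempotents -/

/-- The number `|(G/K)^L|` of `L`-fixed points of the `G`-set `G/K`. -/
def orbitMark {G : Type u} [Group G] (L K : Subgroup G) : ℚ :=
  (Nat.card (MulAction.fixedPoints L (G ⧸ K)) : ℚ)

theorem smul_conj_aut {G : Type u} [Group G] (φ : MulAut G) (g : G) (K : Subgroup G) :
    φ • (MulAut.conj g • K) = MulAut.conj (φ g) • (φ • K) := by
  rw [← mul_smul, ← mul_smul]
  congr 1
  ext x
  simp

/-- `|{x ∈ G : L ≤ x K x⁻¹}| = |(G/K)^L| * |K|`. -/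
theorem card_conj_le {G : Type u} [Group G] [Finite G] (L K : Subgroup G) :
    (Nat.card {x : G // L ≤ MulAut.conj x • K} : ℚ) = orbitMark L K * Nat.card K := by
  unfold orbitMark
  rw [mul_comm, ← Nat.cast_mul, ← Nat.card_prod,
    ← Nat.card_congr (QuotientGroup.preimageMkEquivSubgroupProdSet K
      (MulAction.fixedPoints L (G ⧸ K)))]
  congr 1
  apply Nat.card_congr
  apply Equiv.subtypeEquivRight
  intro x
  simp only [Set.mem_preimage, MulAction.mem_fixedPoints]
  constructor
  · rintro h ⟨l, hl⟩
    have h1 := h hl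
    rw [Subgroup.mem_pointwise_smul_iff_inv_smul_mem, ← map_inv] at h1
    change ((l * x : G) : G ⧸ K) = (x : G ⧸ K)
    refine Eq.symm (QuotientGroup.eq.2 ?_)
    simpa [mul_assoc] using h1
  · intro h l hl
    have h1 : ((l * x : G) : G ⧸ K) = (x : G ⧸ K) := h ⟨l, hl⟩
    have h2 := QuotientGroup.eq.1 h1.symm
    rw [Subgroup.mem_pointwise_smul_iff_inv_smul_mem, ← map_inv]
    simpa [mul_assoc] using h2

theorem card_smul_aut {G : Type u} [Group G] (φ : MulAut G) (K : Subgroup G) :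
    Nat.card (φ • K : Subgroup G) = Nat.card K :=
  Nat.card_congr (Subgroup.equivSMul φ K).toEquiv.symm

theorem orbitMark_eq_of_card {G : Type u} [Group G] [Finite G] {L K L' K' : Subgroup G}
    (hK : Nat.card K' = Nat.card K)
    (h : Nat.card {x : G // L' ≤ MulAut.conj x • K'} = Nat.card {x : G // L ≤ MulAut.conj x • K}) :
    orbitMark L' K' = orbitMark L K := by
  have h1 := card_conj_le L K
  have h2 := card_conj_le L' K'
  rw [h, h1, hK] at h2
  have h3 : (Nat.card K : ℚ) ≠ 0 := Nat.cast_ne_zero.2 Nat.card_pos.ne'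
  exact (mul_right_cancel₀ h3 h2).symm

theorem orbitMark_aut {G : Type u} [Group G] [Finite G] (φ : MulAut G) (L K : Subgroup G) :
    orbitMark (φ • L) (φ • K) = orbitMark L K := by
  refine orbitMark_eq_of_card (card_smul_aut φ K) (Nat.card_congr ?_)
  refine (Equiv.subtypeEquiv φ.toEquiv ?_).symm
  intro x
  change _ ↔ φ • L ≤ MulAut.conj (φ x) • (φ • K)
  rw [← smul_conj_aut, Subgroup.pointwise_smul_le_pointwise_smul_iff]

theorem orbitMark_conj_right {G : Type u} [Group G] [Finite G] (g : G) (L K : Subgroup G) :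
    orbitMark L (MulAut.conj g • K) = orbitMark L K := by
  refine orbitMark_eq_of_card (card_smul_aut _ K) (Nat.card_congr ?_)
  refine Equiv.subtypeEquiv (Equiv.mulRight g) ?_
  intro x
  simp [mul_smul]

theorem orbitMark_conj_left {G : Type u} [Group G] [Finite G] (g : G) (L K : Subgroup G) :
    orbitMark (MulAut.conj g • L) K = orbitMark L K := by
  rw [← orbitMark_conj_right g, orbitMark_aut]

/-- The mark `|(G/K)^L|` as a function of the conjugacy classes `(L)` and `(K)`. -/
def classMark {G : Type u} [Group G] [Finite G] (c d : SubgroupConjClass G) : ℚ :=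
  Quotient.liftOn₂ c d orbitMark (by
    rintro L K _ _ ⟨g, rfl⟩ ⟨h, rfl⟩
    rw [orbitMark_conj_left, orbitMark_conj_right])

/-- The underlying `ℚ`-vector space of the rational Burnside ring `A_ℚ(G)` (the rational
Grothendieck ring of finite `G`-sets), given by its additive basis: the classes `[G/K]` of transitive `G`-sets, one for each
conjugacy class `(K)` of subgroups of `G`. -/
abbrev RationalBurnside (G : Type u) [Group G] : Type u := SubgroupConjClass G →₀ ℚ

/-- The linear map `A_ℚ(G) → ∏_{(L)} ℚ` that sends a finite `G`-set `T` to `(L) ↦ |T^L|`. -/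
def burnsideMarks (G : Type u) [Group G] [Finite G] :
    RationalBurnside G →ₗ[ℚ] (SubgroupConjClass G → ℚ) :=
  Finsupp.linearCombination ℚ (fun d c => classMark c d)

theorem burnsideMarks_apply {G : Type u} [Group G] [Finite G] (a : RationalBurnside G)
    (c : SubgroupConjClass G) :
    burnsideMarks G a c = a.sum (fun d q => q * classMark c d) := by
  simp [burnsideMarks, Finsupp.linearCombination_apply, Finsupp.sum, Finset.sum_apply]

theorem orbitMark_self_ne_zero {G : Type u} [Group G] [Finite G] (K : Subgroup G) :
    orbitMark K K ≠ 0 := by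
  intro h
  have h1 := card_conj_le K K
  rw [h, zero_mul, Nat.cast_eq_zero] at h1
  have : Nonempty {x : G // K ≤ MulAut.conj x • K} := ⟨⟨1, by simp⟩⟩
  exact Nat.card_pos.ne' h1

theorem exists_conj_le_of_orbitMark_ne_zero {G : Type u} [Group G] [Finite G] {L K : Subgroup G}
    (h : orbitMark L K ≠ 0) : ∃ x : G, L ≤ MulAut.conj x • K := by
  by_contra hx
  have h1 := card_conj_le L K
  have : IsEmpty {x : G // L ≤ MulAut.conj x • K} := ⟨fun x => hx ⟨x.1, x.2⟩⟩
  rw [Nat.card_of_isEmpty, Nat.cast_zero] at h1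
  rcases mul_eq_zero.1 h1.symm with h2 | h2
  · exact h h2
  · exact Nat.card_pos.ne' (Nat.cast_eq_zero.1 h2)

/-- The common order of the subgroups in a conjugacy class. -/
def SubgroupConjClass.order {G : Type u} [Group G] (c : SubgroupConjClass G) : ℕ :=
  Quotient.liftOn c (fun K => Nat.card K) (by
    rintro K _ ⟨g, rfl⟩
    exact (card_smul_aut _ K).symm)

theorem eq_of_classMark_ne_zero {G : Type u} [Group G] [Finite G] {c d : SubgroupConjClass G}
    (h : classMark c d ≠ 0) (hcd : d.order ≤ c.order) : c = d := by
  induction c using Quotient.inductionOn with | _ L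
  induction d using Quotient.inductionOn with | _ K
  obtain ⟨x, hx⟩ := exists_conj_le_of_orbitMark_ne_zero (L := L) (K := K) h
  have h1 : Nat.card (MulAut.conj x • K : Subgroup G) ≤ Nat.card L := by
    rw [card_smul_aut]; exact hcd
  have h2 : L = MulAut.conj x • K := Subgroup.eq_of_le_of_card_ge hx h1
  exact (Quotient.sound ⟨x, h2.symm⟩ : SubgroupConjClass.mk K = SubgroupConjClass.mk L).symm

theorem burnsideMarks_injective (G : Type u) [Group G] [Finite G] :
    Function.Injective (burnsideMarks G) := by
  rw [← LinearMap.ker_eq_bot, LinearMap.ker_eq_bot']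
  intro a ha
  by_contra hne
  obtain ⟨c, hc, hmax⟩ := a.support.exists_max_image SubgroupConjClass.order
    (Finsupp.support_nonempty_iff.2 hne)
  have h1 := congrFun ha c
  rw [burnsideMarks_apply, Finsupp.sum, Finset.sum_eq_single c] at h1
  · rcases mul_eq_zero.1 h1 with h2 | h2
    · exact (Finsupp.mem_support_iff.1 hc) h2
    · revert h2
      induction c using Quotient.inductionOn with | _ L
      exact orbitMark_self_ne_zero L
  · intro d hd hdc
    by_contra h2
    exact hdc (eq_of_classMark_ne_zero (right_ne_zero_of_mul h2) (hmax d hd)).symm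
  · intro h; exact absurd hc h

/-- The isomorphism `A_ℚ(G) ≅ ∏_{(L)} ℚ` given by the marks. -/
def burnsideIso (G : Type u) [Group G] [Finite G] :
    RationalBurnside G ≃ₗ[ℚ] (SubgroupConjClass G → ℚ) :=
  LinearEquiv.ofBijective (burnsideMarks G) (by
    refine ⟨burnsideMarks_injective G, ?_⟩
    have : Fintype (SubgroupConjClass G) := Fintype.ofFinite _
    refine (LinearMap.injective_iff_surjective_of_finrank_eq_finrank ?_).1
      (burnsideMarks_injective G)
    simp)

open Classical in
/-- The idempotent `e_H^G ∈ A_ℚ(G)`: the element that corresponds to the characteristic function of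
the conjugacy class `(H)` under `A_ℚ(G) ≅ ∏_{(L)} ℚ`. -/
def burnsideIdempotent {G : Type u} [Group G] [Finite G] (H : Subgroup G) : RationalBurnside G :=
  (burnsideIso G).symm (Pi.single (SubgroupConjClass.mk H) 1)

/-- The action of an automorphism of `G` on the conjugacy classes of subgroups. -/
def SubgroupConjClass.aut {G : Type u} [Group G] (φ : MulAut G) (c : SubgroupConjClass G) :
    SubgroupConjClass G :=
  Quotient.map (fun K : Subgroup G => φ • K) (by
    rintro K _ ⟨g, rfl⟩
    exact ⟨φ g, (smul_conj_aut φ g K).symm⟩) c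

theorem burnsideMarks_aut {G : Type u} [Group G] [Finite G] (φ : MulAut G)
    (a : RationalBurnside G) (c : SubgroupConjClass G) :
    burnsideMarks G (a.mapDomain (SubgroupConjClass.aut φ)) (SubgroupConjClass.aut φ c) =
      burnsideMarks G a c := by
  rw [burnsideMarks_apply, burnsideMarks_apply, Finsupp.sum_mapDomain_index]
  · refine Finsupp.sum_congr fun d _ => ?_
    congr 1
    induction c using Quotient.inductionOn with | _ L
    induction d using Quotient.inductionOn with | _ K
    exact orbitMark_aut φ L K
  · simp
  · intros; ring

theorem burnsideIdempotent_top_aut {G : Type u} [Group G] [Finite G] (φ : MulAut G) :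
    (burnsideIdempotent (⊤ : Subgroup G)).mapDomain (SubgroupConjClass.aut φ) =
      burnsideIdempotent (⊤ : Subgroup G) := by
  classical
  have htop (ψ : MulAut G) : SubgroupConjClass.aut ψ (SubgroupConjClass.mk ⊤) = SubgroupConjClass.mk ⊤ := by
    change SubgroupConjClass.mk (ψ • ⊤) = _
    congr 1
    rw [eq_top_iff]
    intro x _
    rw [Subgroup.mem_pointwise_smul_iff_inv_smul_mem]
    trivial
  have hmarks (c : SubgroupConjClass G) : burnsideMarks G (burnsideIdempotent (⊤ : Subgroup G)) c =
      (Pi.single (SubgroupConjClass.mk ⊤) 1 : SubgroupConjClass G → ℚ) c :=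
    congrFun ((burnsideIso G).apply_symm_apply _) c
  apply burnsideMarks_injective G
  funext c
  have hc : SubgroupConjClass.aut φ (SubgroupConjClass.aut φ⁻¹ c) = c := by
    induction c using Quotient.inductionOn with | _ L
    change SubgroupConjClass.mk (φ • φ⁻¹ • L) = _
    rw [smul_inv_smul]
  rw [← hc, burnsideMarks_aut, hmarks, hc, hmarks]
  by_cases h : c = SubgroupConjClass.mk ⊤
  · rw [h, htop]
  · rw [Pi.single_eq_of_ne h, Pi.single_eq_of_ne]
    intro h1
    apply h
    rw [← hc, h1, htop]

/-! ### Rational Mackey functors -/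

theorem conj_inf_eq {G : Type u} [Group G] (x : G) (K L : Subgroup G) :
    MulAut.conj x • (L ⊓ MulAut.conj x⁻¹ • K) = K ⊓ MulAut.conj x • L := by
  rw [Subgroup.smul_inf, map_inv, smul_inv_smul, inf_comm]

theorem map_subtype_smul {G : Type u} [Group G] (H : Subgroup G) (φ : MulAut H) (g : G)
    (hφ : ∀ x : H, (φ x : G) = g * x * g⁻¹) (K : Subgroup H) :
    MulAut.conj g • K.map H.subtype = (φ • K).map H.subtype := by
  apply SetLike.coe_injective
  change (fun x : G => MulAut.conj g x) '' ((fun x : H => (x : G)) '' (K : Set H)) =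
    (fun x : H => (x : G)) '' ((fun x : H => φ x) '' (K : Set H))
  rw [Set.image_image, Set.image_image]
  exact Set.image_congr fun x _ => (hφ x).symm

/-- A rational `G`-Mackey functor. The value `M(G/H)` is `M.obj H`. The conjugation map
`C_g : M(G/H) → M(G/gHg⁻¹)` is `M.conj g h : M.obj H → M.obj H'`, where `h : g H g⁻¹ = H'`.
In the Mackey axiom `T` runs over all sets of representatives of the double cosets `K\H/L`. -/
structure MackeyFunctor (G : Type u) [Group G] where
  obj : Subgroup G → Type v
  [addCommGroup : ∀ H, AddCommGroup (obj H)]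
  [module : ∀ H, Module ℚ (obj H)]
  res : ∀ {K H : Subgroup G}, K ≤ H → obj H →ₗ[ℚ] obj K
  ind : ∀ {K H : Subgroup G}, K ≤ H → obj K →ₗ[ℚ] obj H
  conj : ∀ (g : G) {H H' : Subgroup G}, MulAut.conj g • H = H' → obj H →ₗ[ℚ] obj H'
  res_refl : ∀ H : Subgroup G, res (le_refl H) = LinearMap.id
  ind_refl : ∀ H : Subgroup G, ind (le_refl H) = LinearMap.id
  conj_of_mem : ∀ (H : Subgroup G) (h : G), h ∈ H → ∀ e : MulAut.conj h • H = H,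
    conj h e = LinearMap.id
  ind_trans : ∀ {L K H : Subgroup G} (hLK : L ≤ K) (hKH : K ≤ H),
    ind (hLK.trans hKH) = ind hKH ∘ₗ ind hLK
  res_trans : ∀ {L K H : Subgroup G} (hLK : L ≤ K) (hKH : K ≤ H),
    res (hLK.trans hKH) = res hLK ∘ₗ res hKH
  conj_mul : ∀ (g h : G) {H H' H'' : Subgroup G} (e : MulAut.conj h • H = H')
    (e' : MulAut.conj g • H' = H'') (e'' : MulAut.conj (g * h) • H = H''),
    conj (g * h) e'' = conj g e' ∘ₗ conj h e
  res_conj : ∀ (g : G) {K H K' H' : Subgroup G} (hKH : K ≤ H) (hKH' : K' ≤ H')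
    (eK : MulAut.conj g • K = K') (eH : MulAut.conj g • H = H'),
    res hKH' ∘ₗ conj g eH = conj g eK ∘ₗ res hKH
  ind_conj : ∀ (g : G) {K H K' H' : Subgroup G} (hKH : K ≤ H) (hKH' : K' ≤ H')
    (eK : MulAut.conj g • K = K') (eH : MulAut.conj g • H = H'),
    ind hKH' ∘ₗ conj g eK = conj g eH ∘ₗ ind hKH
  mackey : ∀ {K L H : Subgroup G} (hK : K ≤ H) (hL : L ≤ H) (T : Finset G),
    (∀ x ∈ T, x ∈ H) →
    (∀ h ∈ H, ∃! x : G, x ∈ T ∧ h ∈ DoubleCoset.doubleCoset x (K : Set G) (L : Set G)) →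
    res hK ∘ₗ ind hL = ∑ x ∈ T,
      ind (inf_le_left : K ⊓ MulAut.conj x • L ≤ K) ∘ₗ
        conj x (conj_inf_eq x K L) ∘ₗ
          res (inf_le_left : L ⊓ MulAut.conj x⁻¹ • K ≤ L)

namespace MackeyFunctor

attribute [instance] MackeyFunctor.addCommGroup MackeyFunctor.module

section Category

variable {G : Type u} [Group G]

/-- A morphism of Mackey functors: linear maps `M(G/H) → N(G/H)` that commute with restriction,
induction and conjugation. -/
@[ext]
structure Hom (M N : MackeyFunctor.{u, v} G) where
  app : ∀ H : Subgroup G, M.obj H →ₗ[ℚ] N.obj H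
  app_res : ∀ {K H : Subgroup G} (h : K ≤ H), app K ∘ₗ M.res h = N.res h ∘ₗ app H
  app_ind : ∀ {K H : Subgroup G} (h : K ≤ H), app H ∘ₗ M.ind h = N.ind h ∘ₗ app K
  app_conj : ∀ (g : G) {H H' : Subgroup G} (e : MulAut.conj g • H = H'),
    app H' ∘ₗ M.conj g e = N.conj g e ∘ₗ app H

/-- The category of rational `G`-Mackey functors. -/
instance : Category (MackeyFunctor.{u, v} G) where
  Hom := Hom
  id M :=
    { app := fun _ => LinearMap.id
      app_res := fun _ => rfl
      app_ind := fun _ => rfl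
      app_conj := fun _ _ _ _ => rfl }
  comp f g :=
    { app := fun H => g.app H ∘ₗ f.app H
      app_res := fun h => by
        rw [LinearMap.comp_assoc, f.app_res, ← LinearMap.comp_assoc, g.app_res,
          LinearMap.comp_assoc]
      app_ind := fun h => by
        rw [LinearMap.comp_assoc, f.app_ind, ← LinearMap.comp_assoc, g.app_ind,
          LinearMap.comp_assoc]
      app_conj := fun x _ _ e => by
        rw [LinearMap.comp_assoc, f.app_conj, ← LinearMap.comp_assoc, g.app_conj,
          LinearMap.comp_assoc] }

end Category

section Weyl

variable {G : Type u} [Group G] (M : MackeyFunctor.{u, v} G)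

/-- The operator `I_K^H ∘ R_K^H` on `M(G/H)`, for a subgroup `K` of the group `H`. -/
def indRes (H : Subgroup G) (K : Subgroup H) : Module.End ℚ (M.obj H) :=
  M.ind (Subgroup.map_subtype_le K) ∘ₗ M.res (Subgroup.map_subtype_le K)

theorem conj_indRes (H : Subgroup G) (K K' : Subgroup H) (g : G) (e : MulAut.conj g • H = H)
    (eK : MulAut.conj g • K.map H.subtype = K'.map H.subtype) :
    M.indRes H K' ∘ₗ M.conj g e = M.conj g e ∘ₗ M.indRes H K := by
  unfold indRes
  rw [LinearMap.comp_assoc, M.res_conj g (Subgroup.map_subtype_le K) _ eK e,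
    ← LinearMap.comp_assoc, M.ind_conj g (Subgroup.map_subtype_le K) _ eK e,
    LinearMap.comp_assoc]

/-- Inner automorphisms of `H` do not change `I_K^H ∘ R_K^H`. -/
theorem indRes_conj (H : Subgroup G) (h : H) (K : Subgroup H) :
    M.indRes H (MulAut.conj h • K) = M.indRes H K := by
  have e : MulAut.conj (h : G) • H = H :=
    Subgroup.mem_normalizer_iff_map_conj_eq.1 (Subgroup.le_normalizer h.2)
  have h1 := M.conj_indRes H K (MulAut.conj h • K) (h : G) e
    (map_subtype_smul H (MulAut.conj h) h (fun _ => rfl) K)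
  rw [M.conj_of_mem H h h.2 e, LinearMap.comp_id, LinearMap.id_comp] at h1
  exact h1

/-- The action of the rational Burnside ring `A_ℚ(H)` on `M(G/H)`: the linear extension of
`[H/K] ↦ I_K^H ∘ R_K^H`. -/
def burnsideAction (H : Subgroup G) : RationalBurnside H →ₗ[ℚ] Module.End ℚ (M.obj H) :=
  Finsupp.linearCombination ℚ (fun c : SubgroupConjClass H =>
    Quotient.liftOn c (M.indRes H) (by
      rintro K _ ⟨h, rfl⟩
      exact (M.indRes_conj H h K).symm))

/-- The subspace `e_H^H M(G/H)` of `M(G/H)`. -/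
def topPart [Finite G] (H : Subgroup G) : Submodule ℚ (M.obj H) :=
  LinearMap.range (M.burnsideAction H (burnsideIdempotent (⊤ : Subgroup H)))

theorem conj_eq_of_mem_normalizer {H : Subgroup G} (n : Subgroup.normalizer (H : Set G)) :
    MulAut.conj (n : G) • H = H :=
  Subgroup.mem_normalizer_iff_map_conj_eq.1 n.2

theorem conj_burnsideAction (H : Subgroup G) (n : Subgroup.normalizer (H : Set G))
    (a : RationalBurnside H) :
    M.burnsideAction H (a.mapDomain (SubgroupConjClass.aut (H.normalizerMonoidHom n))) ∘ₗ
        M.conj n (conj_eq_of_mem_normalizer n) =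
      M.conj n (conj_eq_of_mem_normalizer n) ∘ₗ M.burnsideAction H a := by
  induction a using Finsupp.induction_linear with
  | zero => simp
  | add a b ha hb =>
    rw [Finsupp.mapDomain_add, map_add, map_add, LinearMap.add_comp, LinearMap.comp_add, ha, hb]
  | single c q =>
    rw [Finsupp.mapDomain_single]
    unfold burnsideAction
    rw [Finsupp.linearCombination_single, Finsupp.linearCombination_single, LinearMap.smul_comp,
      LinearMap.comp_smul]
    congr 1
    induction c using Quotient.inductionOn with | _ K
    exact M.conj_indRes H K (H.normalizerMonoidHom n • K) n _
      (map_subtype_smul H _ n (fun _ => rfl) K)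

/-- The representation of `N_G H` on `M(G/H)` by the conjugation maps. -/
def normalizerRep (H : Subgroup G) :
    Representation ℚ (Subgroup.normalizer (H : Set G)) (M.obj H) where
  toFun n := M.conj n (conj_eq_of_mem_normalizer n)
  map_one' := M.conj_of_mem H 1 H.one_mem _
  map_mul' m n := M.conj_mul m n _ _ _

/-- The representation of `W_G H` on `M(G/H)`: the class of `n ∈ N_G H` acts by `C_n`. -/
def weylRep (H : Subgroup G) : Representation ℚ (WeylGroup H) (M.obj H) :=
  QuotientGroup.lift _ (M.normalizerRep H) (fun n hn =>
    M.conj_of_mem H n (Subgroup.mem_subgroupOf.1 hn) _)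

theorem topPart_le_comap [Finite G] (H : Subgroup G) (w : WeylGroup H) :
    M.topPart H ≤ (M.topPart H).comap (M.weylRep H w) := by
  induction w using QuotientGroup.induction_on with | _ n
  rintro _ ⟨x, rfl⟩
  refine ⟨M.conj n (conj_eq_of_mem_normalizer n) x, ?_⟩
  have h := M.conj_burnsideAction H n (burnsideIdempotent ⊤)
  rw [burnsideIdempotent_top_aut] at h
  exact LinearMap.congr_fun h x

/-- The `ℚ[W_G H]`-module `e_H^H M(G/H)`. -/
abbrev topModule [Finite G] (H : Subgroup G) : Type v :=
  ((M.weylRep H).subrepresentation (M.topPart H) (M.topPart_le_comap H)).asModule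

end Weyl

end MackeyFunctor

end

/-!
The idempotent `e_H^H` restricts to zero on every proper subgroup of `H`, because the marks of a
restriction are marks of the original element. Hence `e_H^H M(G/H)` consists of the elements killed
by restriction to all proper subgroups of `H`, and `e_H^H` kills everything induced from a proper
subgroup.

The mark of `m ∈ M(G/H)` at `L ≤ H` is `e_L^L R_L^H m`. The marks determine `m`: if they all vanish,
then by induction on `H` all proper restrictions of `m` vanish, so `m = e_H^H m`, which is the mark
at `H`. In the Mackey formula for `R_L^H I_K^H`, applying `e_L^L` leaves only the double cosets with
`L ≤ hKh⁻¹`, so the mark of `I_K^H m` at `L` is `|K|⁻¹ ∑_h C_h m_h`, where `h` runs over `H` and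
`m_h` is the mark of `m` at `h⁻¹Lh`.

Therefore an equivariant family `f_K : e_K^K M(G/K) → e_K^K N(G/K)` extends to the morphism
`M → N` given by `∑_{K ≤ H} |K|/|H| I_K^H f_K e_K^K R_K^H` on `M(G/H)`: its effect on marks is `f`,
and compatibility with restriction, induction and conjugation can be checked on marks. An
equivariant family is in turn the same as a `W_G H`-equivariant map for one `H` in each conjugacy
class.
-/

noncomputable section

attribute [local instance 2000] Fintype.ofFinite

/-! ### The Mackey formula as a sum over group elements -/

theorem natCast_natCard_ne_zero {R α : Type*} [AddMonoidWithOne R] [CharZero R] [Finite α]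
    [Nonempty α] : (Nat.card α : R) ≠ 0 :=
  Nat.cast_ne_zero.2 Nat.card_pos.ne'

section DoubleCosets

variable {G : Type u} [Group G] {K L H : Subgroup G}

theorem stabilizer_subgroup_quotient_mk (K L : Subgroup G) (x : G) :
    MulAction.stabilizer K (x : G ⧸ L) = (MulAut.conj x • L).subgroupOf K := by
  ext k
  rw [MulAction.mem_stabilizer_iff, Subgroup.mem_subgroupOf,
    Subgroup.mem_pointwise_smul_iff_inv_smul_mem, ← map_inv, eq_comm]
  change ((x : G) : G ⧸ L) = ((k * x : G) : G ⧸ L) ↔ _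
  rw [QuotientGroup.eq]
  simp [mul_assoc]

theorem card_doubleCoset_mul_card_inf [Finite G] (K L : Subgroup G) (x : G) :
    Nat.card (DoubleCoset.doubleCoset x (K : Set G) (L : Set G)) *
      Nat.card (K ⊓ MulAut.conj x • L : Subgroup G) = Nat.card K * Nat.card L := by
  have horbit : (QuotientGroup.mk '' ((K : Set G) * {x}) : Set (G ⧸ L)) =
      MulAction.orbit K (x : G ⧸ L) := by
    rw [Set.mul_singleton, Set.image_image]
    exact Set.image_eq_range _ _
  have hindex : Nat.card (K ⊓ MulAut.conj x • L : Subgroup G) *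
      Nat.card (MulAction.orbit K (x : G ⧸ L)) = Nat.card K := by
    rw [Nat.card_coe_set_eq, ← MulAction.index_stabilizer, stabilizer_subgroup_quotient_mk,
      ← Subgroup.relIndex, ← Subgroup.inf_relIndex_right, inf_comm, ← Subgroup.relIndex_bot_left,
      ← Subgroup.relIndex_bot_left, Subgroup.relIndex_mul_relIndex _ _ _ bot_le inf_le_right]
  rw [DoubleCoset.doubleCoset, Subgroup.card_mul_eq_card_subgroup_mul_card_quotient, horbit,
    ← hindex]
  ring

theorem card_inf_div_eq_inv_card_doubleCoset [Finite G] (𝕜 : Type*) [DivisionRing 𝕜] [CharZero 𝕜]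
    (K L : Subgroup G) (x : G) :
    (Nat.card (K ⊓ MulAut.conj x • L : Subgroup G) : 𝕜) / (Nat.card K * Nat.card L) =
      (Nat.card (DoubleCoset.doubleCoset x (K : Set G) (L : Set G)) : 𝕜)⁻¹ := by
  rw [← Nat.cast_mul (Nat.card K), ← card_doubleCoset_mul_card_inf K L x, Nat.cast_mul,
    div_mul_cancel_right₀ natCast_natCard_ne_zero]

theorem sum_doubleCoset_reps [Finite G] {𝕜 V : Type*} [DivisionRing 𝕜] [CharZero 𝕜]
    [AddCommGroup V] [Module 𝕜 V] (hK : K ≤ H) (hL : L ≤ H) (T : Finset G)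
    (hTH : ∀ x ∈ T, x ∈ H)
    (hT : ∀ h ∈ H, ∃! x : G, x ∈ T ∧ h ∈ DoubleCoset.doubleCoset x (K : Set G) (L : Set G))
    (f : G → V) (hf : ∀ k ∈ K, ∀ x, ∀ l ∈ L, f (k * x * l) = f x) :
    ∑ x ∈ T, f x = ∑ h : H,
      (Nat.card (DoubleCoset.doubleCoset (h : G) (K : Set G) (L : Set G)) : 𝕜)⁻¹ • f h := by
  classical
  choose! r hr huniq using hT
  have hrT (h : H) (_ : h ∈ Finset.univ) : r h ∈ T := (hr h h.2).1
  rw [← Finset.sum_fiberwise_of_maps_to (g := fun h : H => r h) hrT]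
  refine Finset.sum_congr rfl fun x hx => ?_
  have hmem (h : H) : r h = x ↔ (h : G) ∈ DoubleCoset.doubleCoset x (K : Set G) (L : Set G) :=
    ⟨fun e => e ▸ (hr h h.2).2, fun hh => (huniq h h.2 x ⟨hx, hh⟩).symm⟩
  have hcard : Nat.card {h : H // r h = x} =
      Nat.card (DoubleCoset.doubleCoset x (K : Set G) (L : Set G)) := by
    refine Nat.card_congr ((Equiv.subtypeEquivRight hmem).trans
      (Equiv.subtypeSubtypeEquivSubtype ?_))
    intro h hh
    obtain ⟨k, hk, l, hl, rfl⟩ := DoubleCoset.mem_doubleCoset.1 hh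
    exact H.mul_mem (H.mul_mem (hK hk) (hTH x hx)) (hL hl)
  have hpos : (Nat.card (DoubleCoset.doubleCoset x (K : Set G) (L : Set G)) : 𝕜) ≠ 0 := by
    have : Nonempty (DoubleCoset.doubleCoset x (K : Set G) (L : Set G)) :=
      ⟨⟨x, DoubleCoset.mem_doubleCoset_self K L x⟩⟩
    exact natCast_natCard_ne_zero
  have hterm (h : H) (hh : r h = x) :
      (Nat.card (DoubleCoset.doubleCoset (h : G) (K : Set G) (L : Set G)) : 𝕜)⁻¹ • f h =
        (Nat.card (DoubleCoset.doubleCoset x (K : Set G) (L : Set G)) : 𝕜)⁻¹ • f x := by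
    have hhx := (hmem h).1 hh
    rw [DoubleCoset.doubleCoset_eq_of_mem hhx]
    obtain ⟨k, hk, l, hl, e⟩ := DoubleCoset.mem_doubleCoset.1 hhx
    rw [e, hf k hk x l hl]
  rw [Finset.sum_congr rfl fun h hh => hterm h (Finset.mem_filter.1 hh).2, Finset.sum_const,
    ← Fintype.card_subtype, ← Nat.card_eq_fintype_card, hcard, ← Nat.cast_smul_eq_nsmul 𝕜,
    smul_inv_smul₀ hpos]

theorem exists_doubleCoset_reps [Finite G] (hK : K ≤ H) (hL : L ≤ H) :
    ∃ T : Finset G, (∀ x ∈ T, x ∈ H) ∧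
      ∀ h ∈ H, ∃! x : G, x ∈ T ∧ h ∈ DoubleCoset.doubleCoset x (K : Set G) (L : Set G) := by
  classical
  refine ⟨Finset.univ.image fun h : H => (DoubleCoset.mk K L (h : G)).out, ?_, fun h hh => ?_⟩
  · intro x hx
    obtain ⟨h, -, rfl⟩ := Finset.mem_image.1 hx
    obtain ⟨k, l, hk, hl, e⟩ := DoubleCoset.mk_out_eq_mul K L (h : G)
    rw [e]
    exact H.mul_mem (H.mul_mem (hK hk) h.2) (hL hl)
  · refine ⟨(DoubleCoset.mk K L h).out, ⟨Finset.mem_image_of_mem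
      (fun h : H => (DoubleCoset.mk K L (h : G)).out) (Finset.mem_univ ⟨h, hh⟩), ?_⟩, ?_⟩
    · exact DoubleCoset.mem_doubleCoset.2
        ((DoubleCoset.eq K L _ h).1 (DoubleCoset.out_eq' _ _ _))
    · rintro y ⟨hy, hhy⟩
      obtain ⟨h', -, rfl⟩ := Finset.mem_image.1 hy
      have hmk := (DoubleCoset.eq K L _ h).2 (DoubleCoset.mem_doubleCoset.1 hhy)
      rw [DoubleCoset.out_eq'] at hmk
      rw [hmk]

end DoubleCosets

namespace MackeyFunctor

variable {G : Type u} [Group G] (M : MackeyFunctor.{u, v} G)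

/-- The map `I^K_{K ∩ xLx⁻¹} C_x R^L_{L ∩ x⁻¹Kx}` of the Mackey formula. -/
def mackeyTerm (K L : Subgroup G) (x : G) : M.obj L →ₗ[ℚ] M.obj K :=
  M.ind (inf_le_left : K ⊓ MulAut.conj x • L ≤ K) ∘ₗ M.conj x (conj_inf_eq x K L) ∘ₗ
    M.res (inf_le_left : L ⊓ MulAut.conj x⁻¹ • K ≤ L)

/-- `A` and `B` are tied to the intersections by equations only, which avoids casts between
the values of `M` at subgroups that are equal but not syntactically so. -/
theorem mackeyTerm_eq {K L A B : Subgroup G} {x : G} (hA : A ≤ K) (hB : B ≤ L)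
    (e : MulAut.conj x • B = A) (h : A = K ⊓ MulAut.conj x • L) :
    M.mackeyTerm K L x = M.ind hA ∘ₗ M.conj x e ∘ₗ M.res hB := by
  subst h
  obtain rfl : B = L ⊓ MulAut.conj x⁻¹ • K :=
    MulAction.injective (MulAut.conj x) (e.trans (conj_inf_eq x K L).symm)
  rfl

theorem mackeyTerm_mul_left (K L : Subgroup G) {k : G} (hk : k ∈ K) (x : G) :
    M.mackeyTerm K L (k * x) = M.mackeyTerm K L x := by
  have eK := Subgroup.conj_smul_eq_self_of_mem hk
  have e : MulAut.conj (k * x) • (L ⊓ MulAut.conj x⁻¹ • K) = K ⊓ MulAut.conj (k * x) • L := by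
    rw [map_mul, mul_smul, conj_inf_eq, Subgroup.smul_inf, eK, mul_smul]
  have eA : MulAut.conj k • (K ⊓ MulAut.conj x • L) = K ⊓ MulAut.conj (k * x) • L := by
    rw [Subgroup.smul_inf, eK, map_mul, mul_smul]
  rw [M.mackeyTerm_eq inf_le_left inf_le_left e rfl,
    M.conj_mul k x (conj_inf_eq x K L) eA e, LinearMap.comp_assoc, ← LinearMap.comp_assoc,
    M.ind_conj k inf_le_left inf_le_left eA eK, M.conj_of_mem K k hk, LinearMap.id_comp,
    mackeyTerm]

theorem mackeyTerm_mul_right (K L : Subgroup G) (x : G) {l : G} (hl : l ∈ L) :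
    M.mackeyTerm K L (x * l) = M.mackeyTerm K L x := by
  have eL := Subgroup.conj_smul_eq_self_of_mem hl
  have eB : MulAut.conj l • (L ⊓ MulAut.conj (x * l)⁻¹ • K) = L ⊓ MulAut.conj x⁻¹ • K := by
    rw [Subgroup.smul_inf, eL, ← mul_smul, ← map_mul, mul_inv_rev, mul_inv_cancel_left]
  have e : MulAut.conj (x * l) • (L ⊓ MulAut.conj (x * l)⁻¹ • K) = K ⊓ MulAut.conj x • L := by
    rw [map_mul, mul_smul, eB, conj_inf_eq]
  have eA : K ⊓ MulAut.conj x • L = K ⊓ MulAut.conj (x * l) • L := by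
    rw [map_mul, mul_smul, eL]
  rw [M.mackeyTerm_eq inf_le_left inf_le_left e eA,
    M.conj_mul x l eB (conj_inf_eq x K L) e, LinearMap.comp_assoc,
    ← M.res_conj l inf_le_left inf_le_left eB eL, M.conj_of_mem L l hl, LinearMap.comp_id,
    mackeyTerm]

theorem res_comp_ind [Finite G] {K L H : Subgroup G} (hK : K ≤ H) (hL : L ≤ H) :
    M.res hK ∘ₗ M.ind hL = ∑ h : H,
      ((Nat.card (K ⊓ MulAut.conj (h : G) • L : Subgroup G) : ℚ) / (Nat.card K * Nat.card L)) •
        M.mackeyTerm K L h := by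
  obtain ⟨T, hTH, hT⟩ := exists_doubleCoset_reps hK hL
  simp only [card_inf_div_eq_inv_card_doubleCoset]
  rw [M.mackey hK hL T hTH hT]
  exact sum_doubleCoset_reps hK hL T hTH hT (M.mackeyTerm K L) fun k hk x l hl => by
    rw [M.mackeyTerm_mul_right K L _ hl, M.mackeyTerm_mul_left K L hk]

end MackeyFunctor

/-! ### Restriction of the Burnside ring -/

section Burnside

variable {G : Type u} {L : Type v} [Group G] [Group L]

theorem map_conj_smul (φ : L →* G) (l : L) (K : Subgroup L) :
    (MulAut.conj l • K).map φ = MulAut.conj (φ l) • K.map φ := by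
  simp only [Subgroup.pointwise_smul_def]
  ext x
  simp

theorem comap_conj_smul (φ : L →* G) (l : L) (K : Subgroup G) :
    (MulAut.conj (φ l) • K).comap φ = MulAut.conj l • K.comap φ := by
  ext x
  simp [Subgroup.mem_pointwise_smul_iff_inv_smul_mem, ← map_inv]

theorem mk_eq_mk_top_iff {K : Subgroup G} :
    SubgroupConjClass.mk K = SubgroupConjClass.mk ⊤ ↔ K = ⊤ := by
  refine ⟨fun h => ?_, fun h => h ▸ rfl⟩
  obtain ⟨g, hg⟩ := Quotient.exact h
  rw [smul_eq_iff_eq_inv_smul] at hg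
  rw [hg, ← map_inv]
  exact Subgroup.conj_smul_eq_self_of_mem (Subgroup.mem_top _)

/-- The class of the image `φ(K)` as a function of the class of `K`. -/
def SubgroupConjClass.map (φ : L →* G) : SubgroupConjClass L → SubgroupConjClass G :=
  Quotient.map (Subgroup.map φ) (by
    rintro K _ ⟨l, rfl⟩
    exact ⟨φ l, (map_conj_smul φ l K).symm⟩)

section Finite

variable [Finite G] [Finite L]

open Classical in
theorem orbitMark_eq_sum (P K : Subgroup G) :
    orbitMark P K = ∑ x : G, if P ≤ MulAut.conj x • K then (Nat.card K : ℚ)⁻¹ else 0 := by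
  rw [eq_div_of_mul_eq natCast_natCard_ne_zero (card_conj_le P K).symm, div_eq_mul_inv,
    Nat.card_eq_fintype_card, Fintype.card_subtype, ← Finset.sum_filter, Finset.sum_const,
    nsmul_eq_mul]

theorem burnsideMarks_single (c d : SubgroupConjClass G) :
    burnsideMarks G (Finsupp.single d 1) c = classMark c d := by
  simp [burnsideMarks]

theorem burnsideMarks_idempotent_mk_self (H : Subgroup G) :
    burnsideMarks G (burnsideIdempotent H) (SubgroupConjClass.mk H) = 1 := by
  classical
  exact (congrFun ((burnsideIso G).apply_symm_apply _) _).trans (Pi.single_eq_same _ _)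

theorem burnsideMarks_idempotent_of_ne {H : Subgroup G} {c : SubgroupConjClass G}
    (h : c ≠ SubgroupConjClass.mk H) : burnsideMarks G (burnsideIdempotent H) c = 0 := by
  classical
  exact (congrFun ((burnsideIso G).apply_symm_apply _) _).trans (Pi.single_eq_of_ne h _)

theorem classMark_mk_top_self : classMark (SubgroupConjClass.mk (⊤ : Subgroup G))
    (SubgroupConjClass.mk ⊤) = 1 := by
  classical
  change orbitMark (⊤ : Subgroup G) ⊤ = 1
  have htop (x : G) : ⊤ ≤ MulAut.conj x • (⊤ : Subgroup G) :=
    (Subgroup.conj_smul_eq_self_of_mem (Subgroup.mem_top x)).ge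
  rw [orbitMark_eq_sum, Finset.sum_congr rfl fun x _ => if_pos (htop x), Finset.sum_const,
    Finset.card_univ, ← Nat.card_eq_fintype_card, Subgroup.card_top, nsmul_eq_mul,
    mul_inv_cancel₀ natCast_natCard_ne_zero]

theorem burnsideMarks_mk_top (a : RationalBurnside G) :
    burnsideMarks G a (SubgroupConjClass.mk ⊤) = a (SubgroupConjClass.mk ⊤) := by
  rw [burnsideMarks_apply, Finsupp.sum_eq_single (SubgroupConjClass.mk ⊤), classMark_mk_top_self,
    mul_one]
  · intro d _ hd
    induction d using Quotient.inductionOn with | _ K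
    have horder : (SubgroupConjClass.mk K).order ≤ (SubgroupConjClass.mk (⊤ : Subgroup G)).order :=
      Subgroup.card_le_of_le le_top
    by_contra hne
    exact hd (eq_of_classMark_ne_zero (right_ne_zero_of_mul hne) horder).symm
  · exact fun _ => zero_mul _

/-- The ring homomorphism `A_ℚ(G) → A_ℚ(L)` that regards `G`-sets as `L`-sets along `φ`, as a linear
map. Its value is determined by the marks, because `|(φ^* T)^P| = |T^φ(P)|`. -/
def burnsideRestrict (φ : L →* G) : RationalBurnside G →ₗ[ℚ] RationalBurnside L :=
  (burnsideIso L).symm ∘ₗ LinearMap.funLeft ℚ ℚ (SubgroupConjClass.map φ) ∘ₗ burnsideMarks G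

theorem burnsideMarks_restrict (φ : L →* G) (a : RationalBurnside G) (c : SubgroupConjClass L) :
    burnsideMarks L (burnsideRestrict φ a) c = burnsideMarks G a (c.map φ) :=
  congrFun ((burnsideIso L).apply_symm_apply _) c

theorem burnsideRestrict_single (φ : L →* G) (K : Subgroup G) :
    burnsideRestrict φ (Finsupp.single (SubgroupConjClass.mk K) 1) =
      ∑ x : G, ((Nat.card ((MulAut.conj x • K).comap φ) : ℚ) / (Nat.card L * Nat.card K)) •
        Finsupp.single (SubgroupConjClass.mk ((MulAut.conj x • K).comap φ)) 1 := by
  classical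
  apply burnsideMarks_injective L
  funext c
  induction c using Quotient.inductionOn with | _ P
  simp only [burnsideMarks_restrict, map_sum, map_smul, Finset.sum_apply, Pi.smul_apply,
    burnsideMarks_single]
  change orbitMark (P.map φ) K = ∑ x : G, (_ / _) • orbitMark P ((MulAut.conj x • K).comap φ)
  have hterm (x : G) :
      ((Nat.card ((MulAut.conj x • K).comap φ) : ℚ) / (Nat.card L * Nat.card K)) •
        orbitMark P ((MulAut.conj x • K).comap φ) =
      (Nat.card L : ℚ)⁻¹ * ∑ l : L,
        if P.map φ ≤ MulAut.conj (φ l * x) • K then (Nat.card K : ℚ)⁻¹ else 0 := by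
    rw [orbitMark_eq_sum, smul_eq_mul, Finset.mul_sum, Finset.mul_sum]
    refine Finset.sum_congr rfl fun l _ => ?_
    rw [← comap_conj_smul, ← mul_smul, ← map_mul, Subgroup.map_le_iff_le_comap]
    split_ifs
    · have := natCast_natCard_ne_zero (R := ℚ) (α := (MulAut.conj x • K).comap φ)
      field_simp
    · simp
  have hshift (l : L) :
      (∑ x : G, if P.map φ ≤ MulAut.conj (φ l * x) • K then (Nat.card K : ℚ)⁻¹ else 0) =
        orbitMark (P.map φ) K := by
    rw [orbitMark_eq_sum]
    exact Equiv.sum_comp (Equiv.mulLeft (φ l))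
      fun x => if P.map φ ≤ MulAut.conj x • K then (Nat.card K : ℚ)⁻¹ else 0
  rw [Finset.sum_congr rfl fun x _ => hterm x, ← Finset.mul_sum, Finset.sum_comm,
    Finset.sum_congr rfl fun l _ => hshift l, Finset.sum_const, Finset.card_univ,
    ← Nat.card_eq_fintype_card, nsmul_eq_mul, inv_mul_cancel_left₀ natCast_natCard_ne_zero]

theorem burnsideRestrict_idempotent_top {φ : L →* G} (hφ : ¬Function.Surjective φ) :
    burnsideRestrict φ (burnsideIdempotent (⊤ : Subgroup G)) = 0 := by
  apply burnsideMarks_injective L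
  funext c
  rw [burnsideMarks_restrict, map_zero, Pi.zero_apply]
  refine burnsideMarks_idempotent_of_ne fun h => hφ ?_
  induction c using Quotient.inductionOn with | _ P
  rw [← MonoidHom.range_eq_top, eq_top_iff, ← mk_eq_mk_top_iff.1 h]
  exact Subgroup.map_le_range φ P

end Finite
end Burnside

/-! ### The action of the Burnside ring -/

section LinearMaps

variable {R U V W ι : Type*} [CommSemiring R] [AddCommMonoid U] [AddCommMonoid V] [AddCommMonoid W]
  [Module R U] [Module R V] [Module R W]

theorem linearMap_sum_comp (s : Finset ι) (f : ι → V →ₗ[R] W) (g : U →ₗ[R] V) :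
    (∑ i ∈ s, f i) ∘ₗ g = ∑ i ∈ s, f i ∘ₗ g :=
  map_sum (LinearMap.lcomp R W g) f s

theorem linearMap_comp_sum (s : Finset ι) (f : V →ₗ[R] W) (g : ι → U →ₗ[R] V) :
    f ∘ₗ ∑ i ∈ s, g i = ∑ i ∈ s, f ∘ₗ g i :=
  map_sum (LinearMap.llcomp R U V W f) g s

end LinearMaps

section Action

variable {G : Type u} [Group G]

theorem burnside_hom_ext {V : Type*} [AddCommGroup V] [Module ℚ V]
    {f f' : RationalBurnside G →ₗ[ℚ] V}
    (h : ∀ K : Subgroup G, f (Finsupp.single (SubgroupConjClass.mk K) 1) =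
      f' (Finsupp.single (SubgroupConjClass.mk K) 1)) : f = f' :=
  Finsupp.lhom_ext' fun c => LinearMap.ext_ring <| by
    induction c using Quotient.inductionOn with | _ K
    exact h K

theorem map_subtype_comap_inclusion {L H : Subgroup G} (hL : L ≤ H) (J : Subgroup H) :
    (J.comap (Subgroup.inclusion hL)).map L.subtype = L ⊓ J.map H.subtype := by
  ext x
  simp only [Subgroup.mem_map, Subgroup.mem_comap, Subgroup.mem_inf, Subgroup.coe_subtype]
  constructor
  · rintro ⟨l, hl, rfl⟩
    exact ⟨l.2, _, hl, rfl⟩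
  · rintro ⟨hx, y, hy, rfl⟩
    exact ⟨⟨y, hx⟩, hy, rfl⟩

theorem map_subtype_top (H : Subgroup G) : (⊤ : Subgroup H).map H.subtype = H := by
  rw [← MonoidHom.range_eq_map, Subgroup.range_subtype]

theorem map_subtype_lt {H : Subgroup G} {J : Subgroup H} (hJ : J ≠ ⊤) : J.map H.subtype < H :=
  (Subgroup.map_subtype_le J).lt_of_ne fun h =>
    hJ (Subgroup.map_injective H.subtype_injective (h.trans (map_subtype_top H).symm))

theorem inclusion_not_surjective {K H : Subgroup G} (h : K < H) :
    ¬Function.Surjective (Subgroup.inclusion h.le) := by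
  rw [← MonoidHom.range_eq_top, Subgroup.inclusion_range, Subgroup.subgroupOf_eq_top]
  exact h.not_ge

end Action

namespace MackeyFunctor

variable {G : Type u} [Group G] (M : MackeyFunctor.{u, v} G)

theorem indRes_eq {H K : Subgroup G} {J : Subgroup H} (hK : K ≤ H) (h : J.map H.subtype = K) :
    M.indRes H J = M.ind hK ∘ₗ M.res hK := by
  subst h
  rfl

theorem indRes_top (H : Subgroup G) : M.indRes H ⊤ = LinearMap.id := by
  rw [M.indRes_eq le_rfl (map_subtype_top H), M.ind_refl, M.res_refl, LinearMap.id_comp]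

theorem burnsideAction_single (H : Subgroup G) (K : Subgroup H) :
    M.burnsideAction H (Finsupp.single (SubgroupConjClass.mk K) 1) = M.indRes H K := by
  rw [burnsideAction, Finsupp.linearCombination_single, one_smul]
  rfl

theorem mackeyTerm_comp_res {K L H : Subgroup G} (hK : K ≤ H) (hL : L ≤ H) {x : G} (hx : x ∈ H) :
    M.mackeyTerm K L x ∘ₗ M.res hL =
      (M.ind (inf_le_left : K ⊓ MulAut.conj x • L ≤ K) ∘ₗ M.res inf_le_left) ∘ₗ M.res hK := by
  rw [mackeyTerm, LinearMap.comp_assoc, LinearMap.comp_assoc, LinearMap.comp_assoc, ← M.res_trans,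
    ← M.res_trans, ← M.res_conj x _ (inf_le_left.trans hK) (conj_inf_eq x K L)
      (Subgroup.conj_smul_eq_self_of_mem hx), M.conj_of_mem H x hx, LinearMap.comp_id]

theorem ind_comp_mackeyTerm {K L H : Subgroup G} (hK : K ≤ H) (hL : L ≤ H) {x : G} (hx : x ∈ H) :
    M.ind hK ∘ₗ M.mackeyTerm K L x =
      M.ind hL ∘ₗ M.ind (inf_le_left : L ⊓ MulAut.conj x⁻¹ • K ≤ L) ∘ₗ M.res inf_le_left := by
  rw [mackeyTerm, ← LinearMap.comp_assoc, ← LinearMap.comp_assoc, ← M.ind_trans,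
    M.ind_conj x (inf_le_left.trans hL) _ (conj_inf_eq x K L)
      (Subgroup.conj_smul_eq_self_of_mem hx), M.conj_of_mem H x hx, LinearMap.id_comp,
    M.ind_trans inf_le_left hL, LinearMap.comp_assoc]

theorem burnsideAction_apply_of_res_eq_zero {H : Subgroup G} {m : M.obj H}
    (hm : ∀ K (hK : K < H), M.res hK.le m = 0) (a : RationalBurnside H) :
    M.burnsideAction H a m = a (SubgroupConjClass.mk ⊤) • m := by
  classical
  suffices h : LinearMap.applyₗ m ∘ₗ M.burnsideAction H =
      (Finsupp.lapply (SubgroupConjClass.mk ⊤)).smulRight m from LinearMap.congr_fun h a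
  refine burnside_hom_ext fun K => ?_
  change M.burnsideAction H _ m = (Finsupp.single _ (1 : ℚ)) _ • m
  rw [burnsideAction_single, Finsupp.single_apply]
  split_ifs with hK
  · rw [mk_eq_mk_top_iff.1 hK, indRes_top, one_smul, LinearMap.id_apply]
  · have hlt := map_subtype_lt (mt mk_eq_mk_top_iff.2 hK)
    rw [indRes, LinearMap.comp_apply, hm _ hlt, map_zero, zero_smul]

theorem comp_burnsideAction_of_comp_ind_eq_zero {V : Type*} [AddCommGroup V] [Module ℚ V]
    {H : Subgroup G} {f : M.obj H →ₗ[ℚ] V} (hf : ∀ K (hK : K < H), f ∘ₗ M.ind hK.le = 0)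
    (a : RationalBurnside H) : f ∘ₗ M.burnsideAction H a = a (SubgroupConjClass.mk ⊤) • f := by
  classical
  suffices h : LinearMap.llcomp ℚ _ _ _ f ∘ₗ M.burnsideAction H =
      (Finsupp.lapply (SubgroupConjClass.mk ⊤)).smulRight f from LinearMap.congr_fun h a
  refine burnside_hom_ext fun K => ?_
  change f ∘ₗ M.burnsideAction H _ = (Finsupp.single _ (1 : ℚ)) _ • f
  rw [burnsideAction_single, Finsupp.single_apply]
  split_ifs with hK
  · rw [mk_eq_mk_top_iff.1 hK, indRes_top, one_smul, LinearMap.comp_id]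
  · have hlt := map_subtype_lt (mt mk_eq_mk_top_iff.2 hK)
    rw [indRes, ← LinearMap.comp_assoc, hf _ hlt, LinearMap.zero_comp, zero_smul]

section Finite

variable [Finite G]

theorem burnsideAction_restrict_single {L H : Subgroup G} (hL : L ≤ H) (K : Subgroup H) :
    M.burnsideAction L (burnsideRestrict (Subgroup.inclusion hL)
        (Finsupp.single (SubgroupConjClass.mk K) 1)) =
      ∑ h : H, ((Nat.card (L ⊓ MulAut.conj (h : G) • K.map H.subtype : Subgroup G) : ℚ) /
          (Nat.card L * Nat.card (K.map H.subtype))) •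
        (M.ind (inf_le_left : L ⊓ MulAut.conj (h : G) • K.map H.subtype ≤ L) ∘ₗ
          M.res inf_le_left) := by
  simp only [burnsideRestrict_single, map_sum, map_smul, burnsideAction_single]
  refine Finset.sum_congr rfl fun h _ => ?_
  have hmap : ((MulAut.conj h • K).comap (Subgroup.inclusion hL)).map L.subtype =
      L ⊓ MulAut.conj (h : G) • K.map H.subtype := by
    rw [map_subtype_comap_inclusion, map_conj_smul, Subgroup.coe_subtype]
  have hcard := Subgroup.card_map_of_injective
    (K := (MulAut.conj h • K).comap (Subgroup.inclusion hL)) L.subtype_injective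
  rw [hmap] at hcard
  rw [M.indRes_eq inf_le_left hmap, hcard, Subgroup.card_map_of_injective H.subtype_injective]

theorem res_comp_burnsideAction {L H : Subgroup G} (hL : L ≤ H) (a : RationalBurnside H) :
    M.res hL ∘ₗ M.burnsideAction H a =
      M.burnsideAction L (burnsideRestrict (Subgroup.inclusion hL) a) ∘ₗ M.res hL := by
  suffices h : LinearMap.llcomp ℚ _ _ _ (M.res hL) ∘ₗ M.burnsideAction H =
      LinearMap.lcomp ℚ _ (M.res hL) ∘ₗ M.burnsideAction L ∘ₗ
        burnsideRestrict (Subgroup.inclusion hL) from LinearMap.congr_fun h a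
  refine burnside_hom_ext fun K => ?_
  change M.res hL ∘ₗ M.burnsideAction H _ = M.burnsideAction L (burnsideRestrict _ _) ∘ₗ M.res hL
  rw [burnsideAction_single, indRes, ← LinearMap.comp_assoc, res_comp_ind,
    burnsideAction_restrict_single, linearMap_sum_comp, linearMap_sum_comp]
  refine Finset.sum_congr rfl fun h _ => ?_
  rw [LinearMap.smul_comp, LinearMap.smul_comp, mackeyTerm_comp_res _ hL _ h.2]

theorem burnsideAction_comp_ind {L H : Subgroup G} (hL : L ≤ H) (a : RationalBurnside H) :
    M.burnsideAction H a ∘ₗ M.ind hL =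
      M.ind hL ∘ₗ M.burnsideAction L (burnsideRestrict (Subgroup.inclusion hL) a) := by
  suffices h : LinearMap.lcomp ℚ _ (M.ind hL) ∘ₗ M.burnsideAction H =
      LinearMap.llcomp ℚ _ _ _ (M.ind hL) ∘ₗ M.burnsideAction L ∘ₗ
        burnsideRestrict (Subgroup.inclusion hL) from LinearMap.congr_fun h a
  refine burnside_hom_ext fun K => ?_
  change M.burnsideAction H _ ∘ₗ M.ind hL = M.ind hL ∘ₗ M.burnsideAction L (burnsideRestrict _ _)
  rw [burnsideAction_single, indRes, LinearMap.comp_assoc, res_comp_ind,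
    burnsideAction_restrict_single, linearMap_comp_sum, linearMap_comp_sum]
  refine Fintype.sum_equiv (Equiv.inv H) _ _ fun h => ?_
  have hcard : Nat.card (K.map H.subtype ⊓ MulAut.conj (h : G) • L : Subgroup G) =
      Nat.card (L ⊓ MulAut.conj (h : G)⁻¹ • K.map H.subtype : Subgroup G) := by
    rw [← conj_inf_eq, card_smul_aut]
  rw [LinearMap.comp_smul, LinearMap.comp_smul, M.ind_comp_mackeyTerm _ hL h.2, hcard,
    mul_comm (Nat.card L : ℚ)]
  rfl

end Finite
end MackeyFunctor

/-! ### Top parts and marks -/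

section Conjugation

variable {G : Type u} [Group G]

theorem burnsideIdempotent_top_apply_mk_top [Finite G] :
    burnsideIdempotent (⊤ : Subgroup G) (SubgroupConjClass.mk ⊤) = 1 := by
  rw [← burnsideMarks_mk_top, burnsideMarks_idempotent_mk_self]

theorem conj_smul_conj_inv_smul (g : G) (H : Subgroup G) :
    MulAut.conj g • MulAut.conj g⁻¹ • H = H := by
  rw [map_inv, smul_inv_smul]

theorem conj_inv_smul_of_conj_smul {g : G} {H H' : Subgroup G} (e : MulAut.conj g • H = H') :
    MulAut.conj g⁻¹ • H' = H := by
  rw [← e, map_inv, inv_smul_smul]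

theorem conj_smul_lt_conj_smul {H K : Subgroup G} (h : K < H) (g : G) :
    MulAut.conj g • K < MulAut.conj g • H :=
  lt_of_le_not_ge (Subgroup.pointwise_smul_le_pointwise_smul_iff.2 h.le)
    (mt Subgroup.pointwise_smul_le_pointwise_smul_iff.1 h.not_ge)

end Conjugation

namespace MackeyFunctor

variable {G : Type u} [Group G] [Finite G] (M : MackeyFunctor.{u, v} G)

/-- The operator `e_H^H` on `M(G/H)`. -/
def topProj (H : Subgroup G) : Module.End ℚ (M.obj H) :=
  M.burnsideAction H (burnsideIdempotent ⊤)

theorem res_comp_topProj {K H : Subgroup G} (hK : K < H) : M.res hK.le ∘ₗ M.topProj H = 0 := by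
  rw [topProj, res_comp_burnsideAction, burnsideRestrict_idempotent_top
    (inclusion_not_surjective hK), map_zero, LinearMap.zero_comp]

theorem topProj_comp_ind {K H : Subgroup G} (hK : K < H) : M.topProj H ∘ₗ M.ind hK.le = 0 := by
  rw [topProj, burnsideAction_comp_ind, burnsideRestrict_idempotent_top
    (inclusion_not_surjective hK), map_zero, LinearMap.comp_zero]

theorem topProj_apply_of_res_eq_zero {H : Subgroup G} {m : M.obj H}
    (hm : ∀ K (hK : K < H), M.res hK.le m = 0) : M.topProj H m = m := by
  rw [topProj, M.burnsideAction_apply_of_res_eq_zero hm, burnsideIdempotent_top_apply_mk_top,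
    one_smul]

theorem comp_topProj_of_comp_ind_eq_zero {V : Type*} [AddCommGroup V] [Module ℚ V]
    {H : Subgroup G} {f : M.obj H →ₗ[ℚ] V} (hf : ∀ K (hK : K < H), f ∘ₗ M.ind hK.le = 0) :
    f ∘ₗ M.topProj H = f := by
  rw [topProj, M.comp_burnsideAction_of_comp_ind_eq_zero hf, burnsideIdempotent_top_apply_mk_top,
    one_smul]

theorem mem_topPart_iff {H : Subgroup G} {m : M.obj H} :
    m ∈ M.topPart H ↔ ∀ K (hK : K < H), M.res hK.le m = 0 := by
  refine ⟨?_, fun hm => ⟨m, M.topProj_apply_of_res_eq_zero hm⟩⟩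
  rintro ⟨m, rfl⟩ K hK
  exact LinearMap.congr_fun (M.res_comp_topProj hK) m

/-- The projection of `M(G/H)` onto its direct summand `e_H^H M(G/H)`. -/
def toTopPart (H : Subgroup G) : M.obj H →ₗ[ℚ] M.topPart H :=
  (M.topProj H).rangeRestrict

theorem toTopPart_coe {H : Subgroup G} (x : M.topPart H) : M.toTopPart H x = x :=
  Subtype.ext (M.topProj_apply_of_res_eq_zero (M.mem_topPart_iff.1 x.2))

theorem toTopPart_ind {K H : Subgroup G} (hK : K < H) (m : M.obj K) :
    M.toTopPart H (M.ind hK.le m) = 0 :=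
  Subtype.ext (LinearMap.congr_fun (M.topProj_comp_ind hK) m)

theorem conj_mem_topPart (g : G) {H H' : Subgroup G} (e : MulAut.conj g • H = H') {m : M.obj H}
    (hm : m ∈ M.topPart H) : M.conj g e m ∈ M.topPart H' := by
  rw [mem_topPart_iff] at hm ⊢
  intro K hK
  have hK' : MulAut.conj g⁻¹ • K < H :=
    conj_inv_smul_of_conj_smul e ▸ conj_smul_lt_conj_smul hK g⁻¹
  have hres := LinearMap.congr_fun
    (M.res_conj g hK'.le hK.le (conj_smul_conj_inv_smul g K) e) m
  rw [LinearMap.comp_apply, LinearMap.comp_apply, hm _ hK', map_zero] at hres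
  exact hres

/-- The conjugation map `C_g : e_H^H M(G/H) → e_{H'}^{H'} M(G/H')`, where `H' = gHg⁻¹`. -/
def topConj (g : G) {H H' : Subgroup G} (e : MulAut.conj g • H = H') :
    M.topPart H →ₗ[ℚ] M.topPart H' :=
  (M.conj g e).restrict fun _ hm => M.conj_mem_topPart g e hm

theorem topConj_of_mem {H : Subgroup G} {h : G} (hh : h ∈ H) (e : MulAut.conj h • H = H)
    (x : M.topPart H) : M.topConj h e x = x :=
  Subtype.ext (LinearMap.congr_fun (M.conj_of_mem H h hh e) (x : M.obj H))

theorem topConj_mul (g h : G) {H H' H'' : Subgroup G} (e : MulAut.conj h • H = H')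
    (e' : MulAut.conj g • H' = H'') (e'' : MulAut.conj (g * h) • H = H'') (x : M.topPart H) :
    M.topConj (g * h) e'' x = M.topConj g e' (M.topConj h e x) :=
  Subtype.ext (LinearMap.congr_fun (M.conj_mul g h e e' e'') (x : M.obj H))

theorem toTopPart_conj (g : G) {H H' : Subgroup G} (e : MulAut.conj g • H = H') (m : M.obj H) :
    M.toTopPart H' (M.conj g e m) = M.topConj g e (M.toTopPart H m) := by
  have hkill (K) (hK : K < H) : (M.toTopPart H' ∘ₗ M.conj g e) ∘ₗ M.ind hK.le = 0 := by
    have hK' : MulAut.conj g • K < H' := e ▸ conj_smul_lt_conj_smul hK g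
    rw [LinearMap.comp_assoc, ← M.ind_conj g hK.le hK'.le rfl e]
    exact LinearMap.ext fun m => M.toTopPart_ind hK' _
  have hfix := LinearMap.congr_fun (M.comp_topProj_of_comp_ind_eq_zero hkill) m
  exact hfix.symm.trans (M.toTopPart_coe (M.topConj g e (M.toTopPart H m)))

open Classical in
/-- The mark of an element of `M(G/H)` at `L ≤ H`: its image under
`e_L^L R^H_L : M(G/H) → e_L^L M(G/L)`, extended by zero to the subgroups `L` not contained in `H`.
For the Burnside ring this is the number of `L`-fixed points. -/
def mark (H L : Subgroup G) : M.obj H →ₗ[ℚ] M.topPart L :=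
  if h : L ≤ H then M.toTopPart L ∘ₗ M.res h else 0

theorem mark_of_le {H L : Subgroup G} (hL : L ≤ H) (m : M.obj H) :
    M.mark H L m = M.toTopPart L (M.res hL m) := by
  rw [mark, dif_pos hL, LinearMap.comp_apply]

theorem mark_of_not_le {H L : Subgroup G} (hL : ¬L ≤ H) (m : M.obj H) : M.mark H L m = 0 := by
  rw [mark, dif_neg hL, LinearMap.zero_apply]

theorem mark_self (H : Subgroup G) (m : M.obj H) : M.mark H H m = M.toTopPart H m := by
  rw [mark_of_le _ le_rfl, M.res_refl, LinearMap.id_apply]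

theorem mark_res {L K H : Subgroup G} (hL : L ≤ K) (hK : K ≤ H) (m : M.obj H) :
    M.mark K L (M.res hK m) = M.mark H L m := by
  rw [mark_of_le _ hL, mark_of_le _ (hL.trans hK), M.res_trans hL hK, LinearMap.comp_apply]

theorem mark_conj (g : G) {H H' L L' : Subgroup G} (e : MulAut.conj g • H = H')
    (eL : MulAut.conj g • L = L') (m : M.obj H) :
    M.mark H' L' (M.conj g e m) = M.topConj g eL (M.mark H L m) := by
  have hiff : L' ≤ H' ↔ L ≤ H := by
    rw [← e, ← eL, Subgroup.pointwise_smul_le_pointwise_smul_iff]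
  by_cases hL : L ≤ H
  · rw [mark_of_le _ hL, mark_of_le _ (hiff.2 hL), ← toTopPart_conj,
      ← LinearMap.comp_apply (M.res (hiff.2 hL)), M.res_conj g hL (hiff.2 hL) eL e,
      LinearMap.comp_apply]
  · rw [mark_of_not_le _ hL, mark_of_not_le _ (mt hiff.1 hL), map_zero]

theorem mark_coe_self {H : Subgroup G} (x : M.topPart H) : M.mark H H x = x := by
  rw [mark_self, toTopPart_coe]

theorem mark_coe_of_ne {H L : Subgroup G} (hL : L ≠ H) (x : M.topPart H) : M.mark H L x = 0 := by
  by_cases hle : L ≤ H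
  · rw [mark_of_le _ hle, M.mem_topPart_iff.1 x.2 L (hle.lt_of_ne hL), map_zero]
  · exact M.mark_of_not_le hle _

theorem eq_zero_of_mark_eq_zero {H : Subgroup G} {m : M.obj H} (h : ∀ L ≤ H, M.mark H L m = 0) :
    m = 0 := by
  induction H using WellFoundedLT.induction with | _ H ih
  have hres (K) (hK : K < H) : M.res hK.le m = 0 :=
    ih K hK fun L hL => (M.mark_res hL hK.le m).trans (h L (hL.trans hK.le))
  rw [← M.topProj_apply_of_res_eq_zero hres]
  exact congrArg Subtype.val ((M.mark_self H m).symm.trans (h H le_rfl))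

theorem ext_mark {H : Subgroup G} {m m' : M.obj H}
    (h : ∀ L ≤ H, M.mark H L m = M.mark H L m') : m = m' :=
  sub_eq_zero.1 (M.eq_zero_of_mark_eq_zero fun L hL => by rw [map_sub, h L hL, sub_self])

theorem smul_toTopPart_mackeyTerm (L K : Subgroup G) (h : G) (m : M.obj K) :
    ((Nat.card (L ⊓ MulAut.conj h • K : Subgroup G) : ℚ) / (Nat.card L * Nat.card K)) •
        M.toTopPart L (M.mackeyTerm L K h m) =
      (Nat.card K : ℚ)⁻¹ •
        M.topConj h (conj_smul_conj_inv_smul h L) (M.mark K (MulAut.conj h⁻¹ • L) m) := by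
  by_cases hLK : MulAut.conj h⁻¹ • L ≤ K
  · have hinf : L ⊓ MulAut.conj h • K = L := by
      rw [inf_eq_left, Subgroup.subset_pointwise_smul_iff, ← map_inv]
      exact hLK
    rw [M.mackeyTerm_eq le_rfl hLK (conj_smul_conj_inv_smul h L) hinf.symm, mark_of_le _ hLK,
      ← toTopPart_conj, hinf, div_mul_cancel_left₀ natCast_natCard_ne_zero, M.ind_refl]
    rfl
  · have hlt : L ⊓ MulAut.conj h • K < L := by
      refine inf_le_left.lt_of_ne fun hinf => hLK ?_
      rw [map_inv, ← Subgroup.subset_pointwise_smul_iff]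
      exact inf_eq_left.1 hinf
    rw [mark_of_not_le _ hLK, mackeyTerm, LinearMap.comp_apply, toTopPart_ind _ hlt, map_zero,
      smul_zero, smul_zero]

theorem mark_ind {L K H : Subgroup G} (hL : L ≤ H) (hK : K ≤ H) (m : M.obj K) :
    M.mark H L (M.ind hK m) = (Nat.card K : ℚ)⁻¹ • ∑ h : H,
      M.topConj h (conj_smul_conj_inv_smul (h : G) L) (M.mark K (MulAut.conj (h : G)⁻¹ • L) m) := by
  rw [mark_of_le _ hL, ← LinearMap.comp_apply (M.res hL), M.res_comp_ind hL hK,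
    LinearMap.sum_apply, map_sum, Finset.smul_sum]
  refine Finset.sum_congr rfl fun h _ => ?_
  rw [LinearMap.smul_apply, map_smul, smul_toTopPart_mackeyTerm]

end MackeyFunctor

/-! ### Extension of maps of top parts -/

namespace MackeyFunctor

variable {G : Type u} [Group G] [Finite G]

/-- A conjugation-equivariant family of linear maps `e_H^H M(G/H) → e_H^H N(G/H)`, where `H` runs
over all subgroups of `G`. -/
structure TopHom (M N : MackeyFunctor.{u, v} G) where
  app (H : Subgroup G) : M.topPart H →ₗ[ℚ] N.topPart H
  app_conj (g : G) {H H' : Subgroup G} (e : MulAut.conj g • H = H') (x : M.topPart H) :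
    app H' (M.topConj g e x) = N.topConj g e (app H x)

namespace TopHom

variable {M N : MackeyFunctor.{u, v} G} (f : TopHom M N)

/-- The linear map `∑_{K ≤ H} |K|/|H| I_K^H f_K e_K^K R_K^H : M(G/H) → N(G/H)`, whose effect on
marks is `f` by `mark_extend`. -/
def extend (H : Subgroup G) : M.obj H →ₗ[ℚ] N.obj H :=
  ∑ K : Set.Iic H, ((Nat.card K.1 : ℚ) / Nat.card H) •
    N.ind K.2 ∘ₗ (N.topPart K).subtype ∘ₗ f.app K ∘ₗ M.mark H K

theorem topConj_app_mark {H K L : Subgroup G} {h : G} (hh : h ∈ H) (e : MulAut.conj h • K = L)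
    (m : M.obj H) : N.topConj h e (f.app K (M.mark H K m)) = f.app L (M.mark H L m) := by
  have eH : MulAut.conj h • H = H := Subgroup.conj_smul_eq_self_of_mem hh
  rw [← f.app_conj, ← M.mark_conj h eH, M.conj_of_mem H h hh, LinearMap.id_apply]

theorem sum_topConj_mark {H L : Subgroup G} (hL : L ≤ H) (h : H) (m : M.obj H) :
    ∑ K : Set.Iic H, N.topConj h (conj_smul_conj_inv_smul (h : G) L)
        (N.mark K (MulAut.conj (h : G)⁻¹ • L) (f.app K (M.mark H K m))) =
      f.app L (M.mark H L m) := by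
  have hLh : MulAut.conj (h : G)⁻¹ • L ≤ H := by
    rw [map_inv, ← Subgroup.subset_pointwise_smul_iff, Subgroup.conj_smul_eq_self_of_mem h.2]
    exact hL
  rw [Fintype.sum_eq_single ⟨MulAut.conj (h : G)⁻¹ • L, hLh⟩, N.mark_coe_self]
  · exact f.topConj_app_mark h.2 _ m
  · intro K hK
    rw [N.mark_coe_of_ne (fun hLK => hK (Subtype.ext hLK.symm)), map_zero]

theorem mark_extend (H L : Subgroup G) (m : M.obj H) :
    N.mark H L (f.extend H m) = f.app L (M.mark H L m) := by
  by_cases hL : L ≤ H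
  · have hterm (K : Set.Iic H) :
        N.mark H L (((Nat.card K.1 : ℚ) / Nat.card H) • N.ind K.2 (f.app K (M.mark H K m))) =
          (Nat.card H : ℚ)⁻¹ • ∑ h : H, N.topConj h (conj_smul_conj_inv_smul (h : G) L)
            (N.mark K (MulAut.conj (h : G)⁻¹ • L) (f.app K (M.mark H K m))) := by
      rw [map_smul, N.mark_ind hL K.2, smul_smul, div_mul_eq_mul_div,
        mul_inv_cancel₀ natCast_natCard_ne_zero, one_div]
    calc
      N.mark H L (f.extend H m) = ∑ K : Set.Iic H,
          N.mark H L (((Nat.card K.1 : ℚ) / Nat.card H) • N.ind K.2 (f.app K (M.mark H K m))) := by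
        rw [extend, LinearMap.sum_apply, map_sum]
        rfl
      _ = (Nat.card H : ℚ)⁻¹ • ∑ _h : H, f.app L (M.mark H L m) := by
        simp_rw [hterm, ← Finset.smul_sum]
        rw [Finset.sum_comm]
        simp_rw [f.sum_topConj_mark hL]
      _ = f.app L (M.mark H L m) := by
        rw [Finset.sum_const, Finset.card_univ, ← Nat.card_eq_fintype_card,
          ← Nat.cast_smul_eq_nsmul ℚ, inv_smul_smul₀ natCast_natCard_ne_zero]
  · rw [mark_of_not_le _ hL, mark_of_not_le _ hL, map_zero]

theorem extend_res {K H : Subgroup G} (hK : K ≤ H) (m : M.obj H) :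
    f.extend K (M.res hK m) = N.res hK (f.extend H m) :=
  N.ext_mark fun L hL => by
    rw [mark_extend, mark_res _ hL, mark_res _ hL, mark_extend]

theorem extend_ind {K H : Subgroup G} (hK : K ≤ H) (m : M.obj K) :
    f.extend H (M.ind hK m) = N.ind hK (f.extend K m) :=
  N.ext_mark fun L hL => by
    rw [mark_extend, M.mark_ind hL, N.mark_ind hL, map_smul, map_sum]
    simp_rw [mark_extend, f.app_conj]

theorem extend_conj (g : G) {H H' : Subgroup G} (e : MulAut.conj g • H = H') (m : M.obj H) :
    f.extend H' (M.conj g e m) = N.conj g e (f.extend H m) :=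
  N.ext_mark fun L _ => by
    rw [mark_extend, M.mark_conj g e (conj_smul_conj_inv_smul g L),
      N.mark_conj g e (conj_smul_conj_inv_smul g L), mark_extend, f.app_conj]

/-- The morphism of Mackey functors that extends a family of maps on the top parts. -/
def hom : M ⟶ N where
  app := f.extend
  app_res h := LinearMap.ext (f.extend_res h)
  app_ind h := LinearMap.ext (f.extend_ind h)
  app_conj g _ _ e := LinearMap.ext (f.extend_conj g e)

theorem hom_comp_hom {f : TopHom M N} {g : TopHom N M}
    (h : ∀ H x, g.app H (f.app H x) = x) : f.hom ≫ g.hom = 𝟙 M :=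
  Hom.ext <| funext fun H => LinearMap.ext fun m => M.ext_mark fun L _ =>
    (g.mark_extend H L _).trans <| (congrArg _ (f.mark_extend H L m)).trans (h L _)

/-- The isomorphism of Mackey functors given by mutually inverse families of maps on the top
parts. -/
def iso (f : TopHom M N) (g : TopHom N M) (hfg : ∀ H x, g.app H (f.app H x) = x)
    (hgf : ∀ H x, f.app H (g.app H x) = x) : M ≅ N where
  hom := f.hom
  inv := g.hom
  hom_inv_id := hom_comp_hom hfg
  inv_hom_id := hom_comp_hom hgf

end TopHom

end MackeyFunctor

/-! ### Families on conjugacy class representatives -/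

theorem nonempty_asModule_linearEquiv_iff {k G V W : Type*} [CommSemiring k] [Monoid G]
    [AddCommMonoid V] [Module k V] [AddCommMonoid W] [Module k W]
    {ρ : Representation k G V} {σ : Representation k G W} :
    Nonempty (ρ.asModule ≃ₗ[MonoidAlgebra k G] σ.asModule) ↔ Nonempty (ρ.Equiv σ) := by
  constructor
  · rintro ⟨φ⟩
    exact ⟨((Representation.IntertwiningMap.equivLinearMapAsModule ρ σ).symm φ).ofBijective
      φ.bijective⟩
  · rintro ⟨φ⟩
    exact ⟨LinearEquiv.ofBijective
      (Representation.IntertwiningMap.equivLinearMapAsModule ρ σ φ.toIntertwiningMap)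
      φ.toLinearEquiv.bijective⟩

theorem exists_conj_smul_rep_eq {G : Type u} [Group G] {rep : SubgroupConjClass G → Subgroup G}
    (hrep : ∀ c : SubgroupConjClass G, SubgroupConjClass.mk (rep c) = c) (K : Subgroup G) :
    ∃ g : G, MulAut.conj g • rep (SubgroupConjClass.mk K) = K :=
  Quotient.exact (hrep (SubgroupConjClass.mk K))

namespace MackeyFunctor

variable {G : Type u} [Group G] [Finite G]

/-- The representation of `W_G H` on `e_H^H M(G/H)`, whose associated module is `topModule`. -/
abbrev topRep (M : MackeyFunctor.{u, v} G) (H : Subgroup G) :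
    Representation ℚ (WeylGroup H) (M.topPart H) :=
  (M.weylRep H).subrepresentation (M.topPart H) (M.topPart_le_comap H)

variable {M N : MackeyFunctor.{u, v} G}

theorem Hom.app_mem_topPart (f : Hom M N) {H : Subgroup G} {m : M.obj H} (hm : m ∈ M.topPart H) :
    f.app H m ∈ N.topPart H := by
  rw [mem_topPart_iff] at hm ⊢
  intro K hK
  rw [← LinearMap.comp_apply, ← f.app_res hK.le, LinearMap.comp_apply, hm K hK, map_zero]

/-- The isomorphism of `W_G H`-representations `e_H^H M(G/H) ≃ e_H^H N(G/H)` induced by an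
isomorphism of Mackey functors. -/
def topRepEquiv (α : M ≅ N) (H : Subgroup G) : (M.topRep H).Equiv (N.topRep H) :=
  .mk
    (.ofLinearMap ((α.hom.app H).restrict fun _ => α.hom.app_mem_topPart)
      ((α.inv.app H).restrict fun _ => α.inv.app_mem_topPart)
      (LinearMap.ext fun x => Subtype.ext
        (LinearMap.congr_fun (congrFun (congrArg Hom.app α.inv_hom_id) H) x.1))
      (LinearMap.ext fun x => Subtype.ext
        (LinearMap.congr_fun (congrFun (congrArg Hom.app α.hom_inv_id) H) x.1)))
    fun w => by
      induction w using QuotientGroup.induction_on with | _ n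
      exact LinearMap.ext fun x => Subtype.ext
        (LinearMap.congr_fun (α.hom.app_conj n (conj_eq_of_mem_normalizer n)) x.1)

theorem intertwiningMap_topConj {H : Subgroup G} (f : (M.topRep H).IntertwiningMap (N.topRep H))
    {n : G} (e : MulAut.conj n • H = H) (x : M.topPart H) :
    f (M.topConj n e x) = N.topConj n e (f x) :=
  f.isIntertwining _ _
    (QuotientGroup.mk (⟨n, Subgroup.mem_normalizer_iff_map_conj_eq.2 e⟩ :
      Subgroup.normalizer (H : Set G))) x

/-- The map `e_K^K M(G/K) → e_K^K N(G/K)` that corresponds to the map `f` for `H` under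
conjugation by `g`, where `K = gHg⁻¹`. -/
def transport {H K : Subgroup G} (f : M.topPart H →ₗ[ℚ] N.topPart H) (g : G)
    (e : MulAut.conj g • H = K) : M.topPart K →ₗ[ℚ] N.topPart K :=
  N.topConj g e ∘ₗ f ∘ₗ M.topConj g⁻¹ (conj_inv_smul_of_conj_smul e)

theorem transport_topConj {H K : Subgroup G} (f : (M.topRep H).IntertwiningMap (N.topRep H))
    {g g' : G} (e : MulAut.conj g • H = K) (e' : MulAut.conj g' • H = K) (x : M.topPart H) :
    transport f.toLinearMap g e (M.topConj g' e' x) = N.topConj g' e' (f x) := by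
  have en : MulAut.conj (g⁻¹ * g') • H = H := by
    rw [map_mul, mul_smul, e', conj_inv_smul_of_conj_smul e]
  have e'' : MulAut.conj (g * (g⁻¹ * g')) • H = K := by rw [mul_inv_cancel_left, e']
  calc
    transport f.toLinearMap g e (M.topConj g' e' x)
      = N.topConj g e (f (M.topConj (g⁻¹ * g') en x)) := by
        rw [M.topConj_mul g⁻¹ g' e' (conj_inv_smul_of_conj_smul e) en]
        rfl
    _ = N.topConj (g * (g⁻¹ * g')) e'' (f x) := by
        rw [intertwiningMap_topConj, ← N.topConj_mul]
    _ = N.topConj g' e' (f x) := by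
        simp only [mul_inv_cancel_left]

theorem exists_topConj_rep_eq {rep : SubgroupConjClass G → Subgroup G}
    (hrep : ∀ c : SubgroupConjClass G, SubgroupConjClass.mk (rep c) = c)
    (M : MackeyFunctor.{u, v} G) {K : Subgroup G} (x : M.topPart K) :
    ∃ (c : SubgroupConjClass G) (g : G) (e : MulAut.conj g • rep c = K) (y : M.topPart (rep c)),
      M.topConj g e y = x := by
  obtain ⟨g, e⟩ := exists_conj_smul_rep_eq hrep K
  have e' : MulAut.conj (g * g⁻¹) • K = K := by rw [mul_inv_cancel, map_one, one_smul]
  refine ⟨_, g, e, M.topConj g⁻¹ (conj_inv_smul_of_conj_smul e) x, ?_⟩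
  rw [← M.topConj_mul g g⁻¹ _ e e', M.topConj_of_mem (by rw [mul_inv_cancel]; exact K.one_mem)]

namespace TopHom

variable {rep : SubgroupConjClass G → Subgroup G}
  (hrep : ∀ c : SubgroupConjClass G, SubgroupConjClass.mk (rep c) = c)
  (φ : ∀ c, (M.topRep (rep c)).IntertwiningMap (N.topRep (rep c)))

/-- The component at `K` of the equivariant family determined by its components `φ` at the chosen
representatives of the conjugacy classes. -/
def appOfReps (K : Subgroup G) : M.topPart K →ₗ[ℚ] N.topPart K :=
  transport (φ (SubgroupConjClass.mk K)).toLinearMap _ (exists_conj_smul_rep_eq hrep K).choose_spec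

theorem appOfReps_topConj {c : SubgroupConjClass G} {K : Subgroup G} (g : G)
    (e : MulAut.conj g • rep c = K) (x : M.topPart (rep c)) :
    appOfReps hrep φ K (M.topConj g e x) = N.topConj g e (φ c x) := by
  obtain rfl : c = SubgroupConjClass.mk K := (hrep c).symm.trans (Quotient.sound ⟨g, e⟩)
  exact transport_topConj _ _ e x

/-- The equivariant family determined by its components `φ` at the chosen representatives of the
conjugacy classes. -/
def ofReps : TopHom M N where
  app := appOfReps hrep φ
  app_conj g H H' e x := by
    obtain ⟨c, g₀, e₀, y, rfl⟩ := exists_topConj_rep_eq hrep M x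
    have e₁ : MulAut.conj (g * g₀) • rep c = H' := by rw [map_mul, mul_smul, e₀, e]
    rw [← M.topConj_mul g g₀ e₀ e e₁, appOfReps_topConj, appOfReps_topConj, N.topConj_mul]

variable {φ} in
theorem ofReps_app_ofReps_app {ψ : ∀ c, (N.topRep (rep c)).IntertwiningMap (M.topRep (rep c))}
    (h : ∀ c x, ψ c (φ c x) = x) (K : Subgroup G) (x : M.topPart K) :
    (ofReps hrep ψ).app K ((ofReps hrep φ).app K x) = x := by
  obtain ⟨c, g, e, y, rfl⟩ := exists_topConj_rep_eq hrep M x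
  change appOfReps hrep ψ K (appOfReps hrep φ K _) = _
  rw [appOfReps_topConj, appOfReps_topConj, h]

end TopHom

end MackeyFunctor

end

theorem mainTheorem8 {G : Type u} [Group G] [Finite G] (M N : MackeyFunctor.{u, v} G)
    (rep : SubgroupConjClass G → Subgroup G)
    (hrep : ∀ c : SubgroupConjClass G, SubgroupConjClass.mk (rep c) = c) :
    Nonempty (M ≅ N) ↔
      ∀ c : SubgroupConjClass G,
        Nonempty (M.topModule (rep c) ≃ₗ[MonoidAlgebra ℚ (WeylGroup (rep c))]
          N.topModule (rep c)) := by
  constructor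
  · rintro ⟨α⟩ c
    exact nonempty_asModule_linearEquiv_iff.2 ⟨MackeyFunctor.topRepEquiv α (rep c)⟩
  · intro h
    let φ c := (nonempty_asModule_linearEquiv_iff.1 (h c)).some
    let f := MackeyFunctor.TopHom.ofReps hrep fun c => (φ c).toIntertwiningMap
    let g := MackeyFunctor.TopHom.ofReps hrep fun c => (φ c).symm.toIntertwiningMap
    have hfg := MackeyFunctor.TopHom.ofReps_app_ofReps_app hrep fun c => (φ c).symm_apply_apply
    have hgf := MackeyFunctor.TopHom.ofReps_app_ofReps_app hrep fun c => (φ c).apply_symm_apply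
    exact ⟨f.iso g hfg hgf⟩
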